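/- Let $\theta\in\mathbb R$ be a scalar parameter and let $\hat\theta_1\sim N(\theta,s_1^2)$ and $\hat\theta_2\sim N(\theta+b_2,s_2^2)$ be two estimators (with arbitrary joint distribution), where $s_1>0$, $s_2\ge 0$ and $b_2\in\mathbb R$; for $s_2=0$ the law of $\hat\theta_2$ is the point mass at $\theta+b_2$. Suppose that $\mathrm{MSE}(\hat\theta_2)\le \mathrm{MSE}(\hat\theta_1)$, where $\mathrm{MSE}(\hat\theta)=E[(\hat\theta-\theta)^2]$; that is, $b_2^2+s_2^2\le s_1^2$. For $0<\alpha<1$ let $z_{1-\alpha/2}$ be the $(1-\alpha/2)$-quantile of the standard normal distribution and consider the confidence intervals $$\mathrm{CI}_1=\hat\theta_1\pm z_{1-\alpha/2}\,s_1,\qquad \mathrm{CI}_2=\hat\theta_2\pm z_{1-\alpha/2}\,s_1 .$$ The coverage probability of an interval is the probability that it contains $\theta$. Then: 1. The coverage probability of $\mathrm{CI}_1$ equals $1-\alpha$, for every $\alpha\in(0,1)$. 2. If $1-\alpha\ge 0.917$ and $b_2\neq 0$, the coverage probability of $\mathrm{CI}_2$ is strictly above $1-\alpha$. 3. If $1-\alpha=0.9$,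 then for any $b_2$ the coverage probability of $\mathrm{CI}_2$ is at least $90.00\%$ after rounding to two decimals of a percent, i.e. at least $0.89995$. 4. If $1-\alpha=0.9$, the coverage probability of $\mathrm{CI}_2$ increases to $100\%$ as $|b_2|\to s_1$, in the following sense. (a) For each $s_1>0$ and $\varepsilon>0$ there is $\delta>0$, not depending on anything else, such that the coverage probability exceeds $1-\varepsilon$ whenever $|b_2|>s_1-\delta$ (and $\mathrm{MSE}(\hat\theta_2)\le \mathrm{MSE}(\hat\theta_1)$). (b) For each $s_1>0$ there is $b_0<s_1$ such that, whenever $b_0\le|b_2|<|b_2'|$, the coverage probability under $(b_2,s_2)$ with equal MSE, $b_2^2+s_2^2=s_1^2$, is strictly smaller than the coverage probability under any $(b_2',s_2')$ with $b_2'^2+s_2'^2\le s_1^2$. -/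

import Mathlib

open MeasureTheory ProbabilityTheory

noncomputable section

/-- The `p`-quantile of the standard normal distribution, `z_p = inf {x | p ≤ Φ(x)}`. -/
def stdNormalQuantile (p : ℝ) : ℝ :=
  sInf {x : ℝ | p ≤ cdf (gaussianReal 0 1) x}

/-- The mean squared error `E[(est - θ)²]` of an estimator of the scalar parameter `θ`. -/
def MSE {Ω : Type*} [MeasurableSpace Ω] (P : Measure Ω) (est : Ω → ℝ) (θ : ℝ) : ℝ :=
  ∫ ω, (est ω - θ) ^ 2 ∂P

/-- The two-sided interval `est ± z_{1-α/2} s`, as a random set. -/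
def normalCI {Ω : Type*} (est : Ω → ℝ) (s α : ℝ) (ω : Ω) : Set ℝ :=
  Set.Icc (est ω - stdNormalQuantile (1 - α / 2) * s) (est ω + stdNormalQuantile (1 - α / 2) * s)

/-- The probability that the random set `CI` contains the parameter `θ`. -/
def coverageProb {Ω : Type*} [MeasurableSpace Ω] (P : Measure Ω) (CI : Ω → Set ℝ) (θ : ℝ) : ℝ :=
  P.real {ω | θ ∈ CI ω}

/-- The sampling distributions: `est₁ ~ N(θ, s₁²)` is unbiased and `est₂ ~ N(θ + b₂, s₂²)` has
bias `b₂`. No assumption is made on the joint law. The case `s₂ = 0` is the point mass. -/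
structure NormalEstimators {Ω : Type*} [MeasurableSpace Ω] (P : Measure Ω)
    (est₁ est₂ : Ω → ℝ) (θ b₂ s₁ s₂ : ℝ) : Prop where
  s₁_pos : 0 < s₁
  s₂_nonneg : 0 ≤ s₂
  law₁ : HasLaw est₁ (gaussianReal θ (Real.toNNReal (s₁ ^ 2))) P
  law₂ : HasLaw est₂ (gaussianReal (θ + b₂) (Real.toNNReal (s₂ ^ 2))) P

end

/-- The standard normal mass of `[0, x]`, as an odd function of `x`. -/
noncomputable def normalMass (x : ℝ) : ℝ := ∫ t in (0 : ℝ)..x, gaussianPDFReal 0 1 t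

lemma gaussianPDFReal_std (x : ℝ) :
    gaussianPDFReal 0 1 x = (√(2 * Real.pi))⁻¹ * Real.exp (-x ^ 2 / 2) := by
  simp [gaussianPDFReal]

lemma continuous_gaussianPDFReal_std : Continuous (gaussianPDFReal 0 1) := by
  have : gaussianPDFReal 0 1 = fun x => (√(2 * Real.pi))⁻¹ * Real.exp (-x ^ 2 / 2) :=
    funext gaussianPDFReal_std
  rw [this]
  fun_prop

lemma hasDerivAt_normalMass (x : ℝ) : HasDerivAt normalMass (gaussianPDFReal 0 1 x) x :=
  intervalIntegral.integral_hasDerivAt_right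
    (continuous_gaussianPDFReal_std.intervalIntegrable _ _)
    (continuous_gaussianPDFReal_std.stronglyMeasurableAtFilter _ _)
    continuous_gaussianPDFReal_std.continuousAt

lemma continuous_normalMass : Continuous normalMass :=
  continuous_iff_continuousAt.2 fun x => (hasDerivAt_normalMass x).continuousAt

lemma strictMono_normalMass : StrictMono normalMass := by
  apply strictMono_of_deriv_pos
  intro x
  rw [(hasDerivAt_normalMass x).deriv]
  exact gaussianPDFReal_pos _ _ _ one_ne_zero

@[simp] lemma normalMass_zero : normalMass 0 = 0 := by simp [normalMass]

@[simp] lemma normalMass_neg (x : ℝ) : normalMass (-x) = -normalMass x := by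
  have h := intervalIntegral.integral_comp_neg (a := 0) (b := x) (gaussianPDFReal 0 1)
  have h' : (fun t => gaussianPDFReal 0 1 (-t)) = gaussianPDFReal 0 1 := by
    funext t; simp [gaussianPDFReal_std]
  rw [h', neg_zero] at h
  rw [normalMass, normalMass, intervalIntegral.integral_symm, h]

lemma gaussianReal_real_Ioc {a b : ℝ} (hab : a ≤ b) :
    (gaussianReal 0 1).real (Set.Ioc a b) = normalMass b - normalMass a := by
  rw [measureReal_def, gaussianReal_apply_eq_integral _ one_ne_zero, ENNReal.toReal_ofReal
    (integral_nonneg fun x => gaussianPDFReal_nonneg _ _ _),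
    ← intervalIntegral.integral_of_le hab, normalMass, normalMass,
    intervalIntegral.integral_interval_sub_left] <;>
  exact continuous_gaussianPDFReal_std.intervalIntegrable _ _

lemma gaussianReal_real_Icc {a b : ℝ} (hab : a ≤ b) :
    (gaussianReal 0 1).real (Set.Icc a b) = normalMass b - normalMass a := by
  have := nullSingletonClass_gaussianReal (μ := 0) (v := 1) one_ne_zero
  rw [← gaussianReal_real_Ioc hab]
  exact (measureReal_congr Ioc_ae_eq_Icc).symm

lemma normalMass_lt_half (x : ℝ) : normalMass x < 1 / 2 := by
  have h1 : normalMass x < normalMass (|x| + 1) :=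
    strictMono_normalMass (by linarith [le_abs_self x])
  have h2 := gaussianReal_real_Icc (a := -(|x| + 1)) (b := |x| + 1)
    (by linarith [abs_nonneg x])
  have h3 : (gaussianReal 0 1).real (Set.Icc (-(|x| + 1)) (|x| + 1)) ≤ 1 := measureReal_le_one
  rw [h2, normalMass_neg] at h3
  linarith

lemma cdf_gaussianReal_std (x : ℝ) : cdf (gaussianReal 0 1) x = 1 / 2 + normalMass x := by
  have hdiff : ∀ a b : ℝ, a ≤ b →
      cdf (gaussianReal 0 1) b - cdf (gaussianReal 0 1) a = normalMass b - normalMass a := by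
    intro a b hab
    rw [cdf_eq_real, cdf_eq_real, ← gaussianReal_real_Ioc hab, ← Set.Iic_sdiff_Iic,
      measureReal_sdiff (Set.Iic_subset_Iic.2 hab) measurableSet_Iic]
  have h0 : cdf (gaussianReal 0 1) 0 = 1 / 2 := by
    have := nullSingletonClass_gaussianReal (μ := 0) (v := 1) one_ne_zero
    have hneg : (gaussianReal 0 1).real (Set.Iic 0) = (gaussianReal 0 1).real (Set.Ioi 0) := by
      have h := gaussianReal_map_neg (μ := 0) (v := 1)
      rw [neg_zero] at h
      conv_lhs => rw [← h]
      rw [map_measureReal_apply measurable_neg measurableSet_Iic]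
      have : (fun x : ℝ => -x) ⁻¹' Set.Iic 0 = Set.Ici 0 := by ext y; simp
      rw [this]
      exact (measureReal_congr Ioi_ae_eq_Ici).symm
    have hc := probReal_compl_eq_one_sub (μ := gaussianReal 0 1)
      (measurableSet_Iic (a := (0 : ℝ)))
    rw [Set.compl_Iic] at hc
    rw [cdf_eq_real]
    linarith
  rcases le_total 0 x with h | h
  · have := hdiff 0 x h
    rw [h0, normalMass_zero] at this
    linarith
  · have := hdiff x 0 h
    rw [h0, normalMass_zero] at this
    linarith

lemma normalMass_stdNormalQuantile {p : ℝ} (h0 : 0 < p) (h1 : p < 1) :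
    normalMass (stdNormalQuantile p) = p - 1 / 2 := by
  have hcont : Continuous (cdf (gaussianReal 0 1)) := by
    have : (cdf (gaussianReal 0 1) : ℝ → ℝ) = fun x => 1 / 2 + normalMass x :=
      funext cdf_gaussianReal_std
    rw [this]
    exact continuous_const.add continuous_normalMass
  obtain ⟨x, hx⟩ : ∃ x, cdf (gaussianReal 0 1) x = p := by
    refine mem_range_of_exists_le_of_exists_ge hcont ?_ ?_
    · exact ((tendsto_cdf_atBot _).eventually_le_const h0).exists
    · exact ((tendsto_cdf_atTop _).eventually_const_le h1).exists
  have hset : {y : ℝ | p ≤ cdf (gaussianReal 0 1) y} = Set.Ici x := by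
    ext y
    rw [Set.mem_ofPred_eq, ← hx, cdf_gaussianReal_std, cdf_gaussianReal_std, Set.mem_Ici,
      add_le_add_iff_left, strictMono_normalMass.le_iff_le]
  rw [stdNormalQuantile, hset, csInf_Ici]
  rw [cdf_gaussianReal_std] at hx
  linarith

section coverage

variable {Ω : Type*} [MeasurableSpace Ω] {P : Measure Ω}

/-- The mean squared error of a normal estimator is its squared bias plus its variance. -/
lemma MSE_of_hasLaw [IsProbabilityMeasure P] {est : Ω → ℝ} {θ b s : ℝ}
    (h : HasLaw est (gaussianReal (θ + b) (Real.toNNReal (s ^ 2))) P) :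
    MSE P est θ = b ^ 2 + s ^ 2 := by
  have h1 : HasLaw (fun ω => est ω - θ) (gaussianReal b (Real.toNNReal (s ^ 2))) P := by
    simpa using gaussianReal_sub_const h θ
  have hm : MemLp (fun ω => est ω - θ) 2 P := by
    have := memLp_id_gaussianReal' (μ := b) (v := Real.toNNReal (s ^ 2)) 2 (by simp)
    rw [← h1.map_eq] at this
    exact (memLp_map_measure_iff (by fun_prop) h1.aemeasurable).1 this
  have hv := variance_eq_sub hm
  have h2 : Var[fun ω => est ω - θ; P] = s ^ 2 := by
    rw [h1.variance_eq, variance_id_gaussianReal, Real.coe_toNNReal _ (sq_nonneg s)]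
  have h3 : ∫ ω, (est ω - θ) ∂P = b := by
    rw [h1.integral_eq, integral_id_gaussianReal]
  rw [h2, h3] at hv
  have : MSE P est θ = ∫ ω, ((fun ω => est ω - θ) ^ 2) ω ∂P := rfl
  rw [this]
  linarith

lemma coverageProb_normalCI {est : Ω → ℝ} {θ b s s₁ α : ℝ} (hs : 0 < s) (hs₁ : 0 < s₁)
    (hq : 0 ≤ stdNormalQuantile (1 - α / 2))
    (h : HasLaw est (gaussianReal (θ + b) (Real.toNNReal (s ^ 2))) P) :
    coverageProb P (normalCI est s₁ α) θ =
      normalMass ((stdNormalQuantile (1 - α / 2) * s₁ - b) / s) +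
        normalMass ((stdNormalQuantile (1 - α / 2) * s₁ + b) / s) := by
  set q := stdNormalQuantile (1 - α / 2) with hq_def
  have h1 : HasLaw (fun ω => (est ω - (θ + b)) / s) (gaussianReal 0 1) P := by
    have := gaussianReal_div_const (gaussianReal_sub_const h (θ + b)) s
    have hv : Real.toNNReal (s ^ 2) / NNReal.mk (s ^ 2) (sq_nonneg s) = 1 := by
      ext
      rw [NNReal.coe_div, Real.coe_toNNReal _ (sq_nonneg s)]
      exact div_self (by positivity)
    simpa [hv] using this
  have hset : {ω | θ ∈ normalCI est s₁ α ω} =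
      {ω | (est ω - (θ + b)) / s ∈ Set.Icc (-((q * s₁ + b) / s)) ((q * s₁ - b) / s)} := by
    ext ω
    simp only [normalCI, Set.mem_ofPred_eq, Set.mem_Icc, ← hq_def]
    rw [← neg_div, div_le_div_iff_of_pos_right hs, div_le_div_iff_of_pos_right hs]
    constructor <;> rintro ⟨_, _⟩ <;> constructor <;> linarith
  have hle : -((q * s₁ + b) / s) ≤ (q * s₁ - b) / s := by
    rw [← neg_div, div_le_div_iff_of_pos_right hs]
    nlinarith [mul_nonneg hq hs₁.le]
  rw [coverageProb, hset,
    h1.measureReal_eq (p := fun x => x ∈ Set.Icc (-((q * s₁ + b) / s)) ((q * s₁ - b) / s))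
      measurableSet_Icc, Set.ofPred_mem_eq, gaussianReal_real_Icc hle, normalMass_neg]
  ring

lemma coverageProb_normalCI_of_sd_eq_zero [IsProbabilityMeasure P] {est : Ω → ℝ} {θ b s₁ α : ℝ}
    (hb : |b| ≤ stdNormalQuantile (1 - α / 2) * s₁)
    (h : HasLaw est (gaussianReal (θ + b) (Real.toNNReal (0 ^ 2))) P) :
    coverageProb P (normalCI est s₁ α) θ = 1 := by
  have h1 : HasLaw est (Measure.dirac (θ + b)) P := by simpa using h
  have hae := h1.ae_eq_of_dirac
  rw [abs_le] at hb
  have : ∀ᵐ ω ∂P, θ ∈ normalCI est s₁ α ω := by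
    filter_upwards [hae] with ω hω
    simp only [normalCI, Set.mem_Icc, hω]
    constructor <;> linarith
  rw [coverageProb, measureReal_def, measure_congr (Filter.eventuallyEq_univ.2 this)]
  simp

end coverage

/-- Coverage of the interval of half-length `z` centred at a normal estimator with bias `β` and
mean squared error one. -/
noncomputable def boundaryCoverage (z β : ℝ) : ℝ :=
  normalMass ((z - β) / √(1 - β ^ 2)) + normalMass ((z + β) / √(1 - β ^ 2))

lemma boundaryCoverage_zero (z : ℝ) : boundaryCoverage z 0 = 2 * normalMass z := by
  simp [boundaryCoverage, two_mul]

lemma boundaryCoverage_lt_one (z β : ℝ) : boundaryCoverage z β < 1 := by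
  have h1 := normalMass_lt_half ((z - β) / √(1 - β ^ 2))
  have h2 := normalMass_lt_half ((z + β) / √(1 - β ^ 2))
  rw [boundaryCoverage]
  linarith

/-- The positive factor of the derivative of `boundaryCoverage`. -/
noncomputable def boundaryFactor (z β : ℝ) : ℝ :=
  2 * (√(2 * Real.pi))⁻¹ * Real.exp (-(z ^ 2 + β ^ 2) / (2 * (1 - β ^ 2))) / √(1 - β ^ 2) ^ 3

lemma boundaryFactor_pos (z : ℝ) {β : ℝ} (hβ : β ^ 2 < 1) : 0 < boundaryFactor z β := by
  have : 0 < √(1 - β ^ 2) := Real.sqrt_pos.2 (by linarith)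
  have := Real.pi_pos
  unfold boundaryFactor
  positivity

/-- The factor that carries the sign of the derivative of `boundaryCoverage`. -/
noncomputable def boundarySign (z β : ℝ) : ℝ :=
  z * β * Real.cosh (z * β / (1 - β ^ 2)) - Real.sinh (z * β / (1 - β ^ 2))

lemma hasDerivAt_boundaryCoverage (z : ℝ) {β : ℝ} (hβ : β ^ 2 < 1) :
    HasDerivAt (boundaryCoverage z) (boundaryFactor z β * boundarySign z β) β := by
  have hy : 0 < 1 - β ^ 2 := by linarith
  have hτ : 0 < √(1 - β ^ 2) := Real.sqrt_pos.2 hy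
  have hτ2 : √(1 - β ^ 2) ^ 2 = 1 - β ^ 2 := Real.sq_sqrt hy.le
  have hsq : HasDerivAt (fun b : ℝ => √(1 - b ^ 2)) (-(2 * β) / (2 * √(1 - β ^ 2))) β := by
    have h : HasDerivAt (fun b : ℝ => 1 - b ^ 2) (-(2 * β)) β := by
      simpa using (hasDerivAt_pow 2 β).const_sub 1
    exact h.sqrt hy.ne'
  have hu : HasDerivAt (fun b : ℝ => (z - b) / √(1 - b ^ 2))
      ((z * β - 1) / √(1 - β ^ 2) ^ 3) β := by
    refine (((hasDerivAt_id β).const_sub z).div hsq hτ.ne').congr_deriv ?_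
    simp only [id]
    set τ := √(1 - β ^ 2)
    have h2 : β ^ 2 = 1 - τ ^ 2 := by linarith
    field_simp
    linear_combination -h2
  have hv : HasDerivAt (fun b : ℝ => (z + b) / √(1 - b ^ 2))
      ((z * β + 1) / √(1 - β ^ 2) ^ 3) β := by
    refine (((hasDerivAt_id β).const_add z).div hsq hτ.ne').congr_deriv ?_
    simp only [id]
    set τ := √(1 - β ^ 2)
    have h2 : β ^ 2 = 1 - τ ^ 2 := by linarith
    field_simp
    linear_combination h2
  have hd := ((hasDerivAt_normalMass ((z - β) / √(1 - β ^ 2))).comp β hu).add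
    ((hasDerivAt_normalMass ((z + β) / √(1 - β ^ 2))).comp β hv)
  refine HasDerivAt.congr_deriv hd ?_
  rw [gaussianPDFReal_std, gaussianPDFReal_std, boundaryFactor, boundarySign, Real.cosh_eq,
    Real.sinh_eq]
  have e1 : -((z - β) / √(1 - β ^ 2)) ^ 2 / 2 =
      -(z ^ 2 + β ^ 2) / (2 * (1 - β ^ 2)) + z * β / (1 - β ^ 2) := by
    rw [div_pow, hτ2]; field_simp; ring
  have e2 : -((z + β) / √(1 - β ^ 2)) ^ 2 / 2 =
      -(z ^ 2 + β ^ 2) / (2 * (1 - β ^ 2)) + -(z * β / (1 - β ^ 2)) := by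
    rw [div_pow, hτ2]; field_simp; ring
  rw [e1, e2, Real.exp_add, Real.exp_add]
  field_simp
  ring

lemma mul_cosh_sub_sinh_ge {w y : ℝ} (hw : 0 ≤ w) (hy : y ≤ 2 / 3) :
    -w * y + w ^ 3 * (2 - 3 * y) / 6 + w ^ 5 * (4 - 5 * y) / 120 ≤
      w * (1 - y) * Real.cosh w - Real.sinh w := by
  have h := ((Real.hasSum_cosh w).mul_left (w * (1 - y))).sub (Real.hasSum_sinh w)
  have hle := sum_le_hasSum (Finset.range 3) (fun k hk => ?_) h
  · refine le_trans (le_of_eq ?_) hle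
    simp [Finset.sum_range_succ, Nat.factorial]
    ring
  · have hk3 : 3 ≤ k := by simpa using hk
    have hk' : (3 : ℝ) ≤ k := by exact_mod_cast hk3
    have e : w * (1 - y) * (w ^ (2 * k) / ((2 * k).factorial : ℝ)) -
        w ^ (2 * k + 1) / ((2 * k + 1).factorial : ℝ) =
        w ^ (2 * k + 1) / ((2 * k + 1).factorial : ℝ) * ((1 - y) * (2 * k + 1) - 1) := by
      rw [Nat.factorial_succ, pow_succ]
      push_cast
      field_simp
    rw [e]
    have : 0 ≤ (1 - y) * (2 * k + 1) - 1 := by nlinarith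
    positivity

/-- The polynomial that decides the sign of the truncated series of `boundarySign`, with
`s = z²` and `y = β²`. -/
noncomputable def signPoly (s y : ℝ) : ℝ :=
  (1 - y) ^ 4 - s * (2 - 3 * y) * (1 - y) ^ 2 / 6 - s ^ 2 * y * (4 - 5 * y) / 120

lemma boundarySign_ge {z β : ℝ} (hz : 0 ≤ z) (hβ : 0 ≤ β) (hy : β ^ 2 ≤ 2 / 3) :
    -(z * β * β ^ 2 / (1 - β ^ 2) ^ 5 * signPoly (z ^ 2) (β ^ 2)) ≤ boundarySign z β := by
  have h1 : 0 < 1 - β ^ 2 := by linarith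
  have h := mul_cosh_sub_sinh_ge (w := z * β / (1 - β ^ 2)) (by positivity) hy
  rw [div_mul_cancel₀ _ h1.ne'] at h
  refine le_trans (le_of_eq ?_) h
  unfold signPoly
  field_simp
  ring

lemma boundarySign_pos_of_one_le {z β : ℝ} (h : 1 ≤ z * β) : 0 < boundarySign z β := by
  unfold boundarySign
  nlinarith [Real.sinh_lt_cosh (z * β / (1 - β ^ 2)), Real.cosh_pos (z * β / (1 - β ^ 2))]

/-- `boundaryCoverage` is strictly increasing where `boundarySign` is positive. -/
lemma boundaryCoverage_lt {z a b : ℝ} (ha : 0 ≤ a) (hab : a < b) (hb : b < 1)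
    (h : ∀ β, a < β → β < b → 0 < boundarySign z β) :
    boundaryCoverage z a < boundaryCoverage z b := by
  have hlt : ∀ β ∈ Set.Icc a b, β ^ 2 < 1 := fun β hβ => by nlinarith [hβ.1, hβ.2]
  refine strictMonoOn_of_deriv_pos (convex_Icc a b) (fun β hβ =>
    (hasDerivAt_boundaryCoverage z (hlt β hβ)).continuousAt.continuousWithinAt) ?_
    (Set.left_mem_Icc.2 hab.le) (Set.right_mem_Icc.2 hab.le) hab
  intro β hβ
  rw [interior_Icc] at hβ
  rw [(hasDerivAt_boundaryCoverage z (hlt β (Set.Ioo_subset_Icc_self hβ))).deriv]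
  exact mul_pos (boundaryFactor_pos z (hlt β (Set.Ioo_subset_Icc_self hβ))) (h β hβ.1 hβ.2)

lemma boundarySign_pos_of_three_le {z β : ℝ} (hz : 0 ≤ z) (hz3 : 3 ≤ z ^ 2) (hβ : 0 < β) :
    0 < boundarySign z β := by
  rcases le_or_gt 1 (z * β) with h | h
  · exact boundarySign_pos_of_one_le h
  · have hz0 : 0 < z := by nlinarith
    have hx : z ^ 2 * β ^ 2 < 1 := by
      rw [← mul_pow]; exact pow_lt_one₀ (by positivity) h two_ne_zero
    have hb2 : 0 < β ^ 2 := by positivity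
    have hy : β ^ 2 < 1 / 3 := by nlinarith
    refine lt_of_lt_of_le ?_ (boundarySign_ge hz hβ.le (by linarith))
    have h1 : 0 < 1 - β ^ 2 := by linarith
    have hneg : signPoly (z ^ 2) (β ^ 2) < 0 := by
      unfold signPoly
      set y := β ^ 2
      set s := z ^ 2
      have e1 : 0 ≤ (s - 3) * ((2 - 3 * y) * (1 - y) ^ 2) :=
        mul_nonneg (by linarith) (mul_nonneg (by linarith) (sq_nonneg _))
      have e2 : 0 ≤ s ^ 2 * y * (4 - 5 * y) :=
        mul_nonneg (by positivity) (by linarith)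
      have e3 : 0 < (1 - y) ^ 2 * (y * (1 / 2 - y)) :=
        mul_pos (by positivity) (mul_pos hb2 (by linarith))
      nlinarith
    have : 0 < z * β * β ^ 2 / (1 - β ^ 2) ^ 5 := by positivity
    nlinarith

lemma boundaryCoverage_zero_lt {z β : ℝ} (hz : 0 ≤ z) (hz3 : 3 ≤ z ^ 2) (hβ : 0 < β)
    (hβ1 : β < 1) : 2 * normalMass z < boundaryCoverage z β := by
  rw [← boundaryCoverage_zero]
  exact boundaryCoverage_lt le_rfl hβ hβ1
    fun b hb _ => boundarySign_pos_of_three_le hz hz3 hb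

lemma exp_neg_taylor_alternating (n : ℕ) : ∀ t : ℝ, 0 ≤ t →
    0 ≤ (-1) ^ n * (∑ k ∈ Finset.range (n + 1), (-t) ^ k / (k.factorial : ℝ) - Real.exp (-t)) := by
  induction n with
  | zero => intro t ht; simpa using ht
  | succ n ih =>
    intro t ht
    have hd : ∀ u : ℝ, HasDerivAt (fun u : ℝ => (-1 : ℝ) ^ (n + 1) *
        (∑ k ∈ Finset.range (n + 1 + 1), (-u) ^ k / (k.factorial : ℝ) - Real.exp (-u)))
        ((-1) ^ n * (∑ k ∈ Finset.range (n + 1), (-u) ^ k / (k.factorial : ℝ) -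
          Real.exp (-u))) u := by
      intro u
      have h1 : HasDerivAt (fun u : ℝ => ∑ k ∈ Finset.range (n + 1 + 1),
          (-u) ^ k / (k.factorial : ℝ))
          (∑ k ∈ Finset.range (n + 1 + 1), (k * (-u) ^ (k - 1) * (-1)) / (k.factorial : ℝ)) u :=
        HasDerivAt.fun_sum fun k _ => ((hasDerivAt_neg u).fun_pow k).div_const _
      refine ((h1.sub (hasDerivAt_neg u).exp).const_mul _).congr_deriv ?_
      rw [Finset.sum_range_succ']
      have : ∀ k ∈ Finset.range (n + 1),
          (((k + 1 : ℕ) : ℝ) * (-u) ^ (k + 1 - 1) * (-1)) / ((k + 1).factorial : ℝ) =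
          -((-u) ^ k / (k.factorial : ℝ)) := by
        intro k _
        rw [Nat.factorial_succ]
        push_cast
        field_simp
      rw [Finset.sum_congr rfl this, Finset.sum_neg_distrib]
      simp only [Nat.cast_zero]
      ring
    have hmono := monotoneOn_of_deriv_nonneg (convex_Ici (0 : ℝ))
      (fun u _ => (hd u).continuousAt.continuousWithinAt)
      (fun u _ => (hd u).differentiableAt.differentiableWithinAt)
      (fun u hu => by
        rw [interior_Ici] at hu
        rw [(hd u).deriv]
        exact ih u (le_of_lt hu))
    have h0 := hmono (Set.mem_Ici.2 le_rfl) (Set.mem_Ici.2 ht) ht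
    refine le_trans (le_of_eq ?_) h0
    beta_reduce
    rw [Finset.sum_range_succ']
    simp

lemma normalMass_le_taylor (m : ℕ) {x : ℝ} (hx : 0 ≤ x) :
    normalMass x ≤ (√(2 * Real.pi))⁻¹ * ∑ k ∈ Finset.range (2 * m + 1),
      x ^ (2 * k + 1) * ((-1 / 2) ^ k / ((k.factorial : ℝ) * (2 * k + 1))) := by
  have hd : ∀ u : ℝ, HasDerivAt (fun u : ℝ => (√(2 * Real.pi))⁻¹ *
      ∑ k ∈ Finset.range (2 * m + 1),
        u ^ (2 * k + 1) * ((-1 / 2) ^ k / ((k.factorial : ℝ) * (2 * k + 1))) - normalMass u)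
      ((√(2 * Real.pi))⁻¹ * ((-1) ^ (2 * m) * (∑ k ∈ Finset.range (2 * m + 1),
        (-(u ^ 2 / 2)) ^ k / (k.factorial : ℝ) - Real.exp (-(u ^ 2 / 2))))) u := by
    intro u
    have h1 : HasDerivAt (fun u : ℝ => ∑ k ∈ Finset.range (2 * m + 1),
        u ^ (2 * k + 1) * ((-1 / 2) ^ k / ((k.factorial : ℝ) * (2 * k + 1))))
        (∑ k ∈ Finset.range (2 * m + 1), ((2 * k + 1 : ℕ) : ℝ) * u ^ (2 * k + 1 - 1) *
          ((-1 / 2) ^ k / ((k.factorial : ℝ) * (2 * k + 1)))) u :=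
      HasDerivAt.fun_sum fun k _ => (hasDerivAt_pow (2 * k + 1) u).mul_const _
    refine ((h1.const_mul _).sub (hasDerivAt_normalMass u)).congr_deriv ?_
    have : ∀ k ∈ Finset.range (2 * m + 1), ((2 * k + 1 : ℕ) : ℝ) * u ^ (2 * k + 1 - 1) *
        ((-1 / 2) ^ k / ((k.factorial : ℝ) * (2 * k + 1))) =
        (-(u ^ 2 / 2)) ^ k / (k.factorial : ℝ) := by
      intro k _
      have e : -(u ^ 2 / 2) = u ^ 2 * (-1 / 2) := by ring
      rw [e, mul_pow, ← pow_mul, Nat.add_sub_cancel]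
      push_cast
      field_simp
    rw [Finset.sum_congr rfl this, gaussianPDFReal_std, neg_div, pow_mul]
    norm_num
    ring
  have hmono := monotone_of_deriv_nonneg (fun u => (hd u).differentiableAt) (fun u => by
    rw [(hd u).deriv]
    exact mul_nonneg (by positivity) (exp_neg_taylor_alternating (2 * m) _ (by positivity)))
  have h0 := hmono hx
  simpa [-mul_inv_rev, -Real.sqrt_mul] using h0

lemma inv_sqrt_two_pi_lt : (√(2 * Real.pi))⁻¹ < 0.398944 := by
  have h : (2.50662 : ℝ) < √(2 * Real.pi) := by
    apply Real.lt_sqrt_of_sq_lt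
    nlinarith [Real.pi_gt_d6]
  calc (√(2 * Real.pi))⁻¹ < (2.50662 : ℝ)⁻¹ := inv_strictAnti₀ (by norm_num) h
    _ < 0.398944 := by norm_num

lemma normalMass_lt_of_sqrt_three : normalMass 1.7325 < 0.4585 := by
  refine (normalMass_le_taylor 4 (by norm_num)).trans_lt ?_
  refine (mul_le_mul_of_nonneg_right inv_sqrt_two_pi_lt.le ?_).trans_lt ?_ <;>
  norm_num [Finset.sum_range_succ, Nat.factorial]

lemma normalMass_lt_nine_twentieths : normalMass 1.6446 < 0.45 := by
  refine (normalMass_le_taylor 4 (by norm_num)).trans_lt ?_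
  refine (mul_le_mul_of_nonneg_right inv_sqrt_two_pi_lt.le ?_).trans_lt ?_ <;>
  norm_num [Finset.sum_range_succ, Nat.factorial]

lemma mul_inv_sqrt_two_pi_le {z : ℝ} (hz : 1.6446 ≤ z) :
    z * (√(2 * Real.pi))⁻¹ ≤ 0.17 * Real.exp (z ^ 2 / 2) := by
  have h0 : (3.862 : ℝ) ≤ Real.exp 1.352355 := by
    refine le_trans ?_ (Real.sum_le_exp_of_nonneg (by norm_num) 9)
    norm_num [Finset.sum_range_succ, Nat.factorial]
  have h1 := Real.add_one_le_exp (z ^ 2 / 2 - 1.352355)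
  have h2 : Real.exp (z ^ 2 / 2) = Real.exp 1.352355 * Real.exp (z ^ 2 / 2 - 1.352355) := by
    rw [← Real.exp_add]; congr 1; ring
  have h3 : 0 ≤ z ^ 2 / 2 - 1.352355 + 1 := by nlinarith
  have h4 : 3.862 * (z ^ 2 / 2 - 1.352355 + 1) ≤ Real.exp (z ^ 2 / 2) := by
    rw [h2]
    exact mul_le_mul h0 h1 h3 (Real.exp_pos _).le
  have h5 : z * (√(2 * Real.pi))⁻¹ ≤ z * 0.398944 :=
    mul_le_mul_of_nonneg_left inv_sqrt_two_pi_lt.le (by linarith)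
  nlinarith

/-- A polynomial bound for the growth of `boundaryFactor` on `y = β² ≤ 0.126`. -/
noncomputable def growthPoly (y : ℝ) : ℝ := 1 + 4.7 * y + 13 * y ^ 2 + 30 * y ^ 3

lemma growthPoly_pos {y : ℝ} (hy : 0 ≤ y) : 0 < growthPoly y := by
  unfold growthPoly; positivity

lemma exp_neg_le_growthPoly {y : ℝ} (hy : 0 ≤ y) (hy1 : y ≤ 0.126) :
    Real.exp (-(3.7047 / 2 * (y / (1 - y)))) ≤ growthPoly y * √(1 - y) ^ 13 := by
  have hd : ∀ u ∈ Set.Icc (0 : ℝ) 0.126, HasDerivAt (fun u : ℝ => Real.log (growthPoly u) +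
      13 / 2 * Real.log (1 - u) + 3.7047 / 2 * (u / (1 - u)))
      ((4.7 + 26 * u + 90 * u ^ 2) / growthPoly u + 13 / 2 * (-1 / (1 - u)) +
        3.7047 / 2 * (1 / (1 - u) ^ 2)) u := by
    intro u hu
    have hu1 : 1 - u ≠ 0 := by linarith [hu.2]
    have h1 : HasDerivAt growthPoly (4.7 + 26 * u + 90 * u ^ 2) u := by
      refine ((((hasDerivAt_id u).const_mul 4.7).const_add 1).add
        ((hasDerivAt_pow 2 u).const_mul 13)).add ((hasDerivAt_pow 3 u).const_mul 30)
        |>.congr_deriv ?_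
      push_cast; ring
    have h2 : HasDerivAt (fun u : ℝ => 1 - u) (-1) u := (hasDerivAt_id u).const_sub 1
    refine ((h1.log (growthPoly_pos hu.1).ne').add ((h2.log hu1).const_mul (13 / 2))).add
      (((hasDerivAt_id u).div h2 hu1).const_mul (3.7047 / 2)) |>.congr_deriv ?_
    congr 2
    simp
  have hmono := monotoneOn_of_deriv_nonneg (convex_Icc (0 : ℝ) 0.126)
    (fun u hu => (hd u hu).continuousAt.continuousWithinAt)
    (fun u hu => (hd u (interior_subset hu)).differentiableAt.differentiableWithinAt)
    (fun u hu => by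
      have hu' := interior_subset hu
      rw [(hd u hu').deriv]
      have h1 : 0 < 1 - u := by linarith [hu'.2]
      have hP := growthPoly_pos hu'.1
      have e : (4.7 + 26 * u + 90 * u ^ 2) / growthPoly u + 13 / 2 * (-1 / (1 - u)) +
        3.7047 / 2 * (1 / (1 - u) ^ 2) = ((4.7 + 26 * u + 90 * u ^ 2) * (2 * (1 - u) ^ 2) -
          growthPoly u * (13 * (1 - u) - 3.7047)) / (2 * growthPoly u * (1 - u) ^ 2) := by
        field_simp; ring
      rw [e]
      refine div_nonneg ?_ (by positivity)
      unfold growthPoly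
      obtain ⟨h2, h3⟩ := hu'
      nlinarith [mul_nonneg h2 (sub_nonneg.2 h3), mul_nonneg (sq_nonneg u) (sub_nonneg.2 h3),
        mul_nonneg (pow_nonneg h2 3) (sub_nonneg.2 h3), pow_nonneg h2 3, pow_nonneg h2 4])
  have h := hmono (Set.left_mem_Icc.2 (by norm_num)) ⟨hy, hy1⟩ hy
  have h1 : 0 < 1 - y := by linarith
  simp only [growthPoly] at h
  norm_num at h
  have hτ : 0 < √(1 - y) := Real.sqrt_pos.2 h1
  have hP := growthPoly_pos hy
  rw [← Real.le_log_iff_exp_le (by positivity), Real.log_mul hP.ne' (by positivity),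
    Real.log_pow, Real.log_sqrt h1.le]
  unfold growthPoly
  push_cast
  norm_num
  linarith

lemma signPoly_le {s y : ℝ} (hs : 2.7047 ≤ s) (hy0 : 0 ≤ y) (hy : y ≤ 2 / 3) :
    signPoly s y ≤ signPoly 2.7047 y := by
  unfold signPoly
  have h1 : 0 ≤ (s - 2.7047) * ((2 - 3 * y) * (1 - y) ^ 2) :=
    mul_nonneg (by linarith) (mul_nonneg (by linarith) (sq_nonneg _))
  have h2 : 0 ≤ (s ^ 2 - 2.7047 ^ 2) * (y * (4 - 5 * y)) :=
    mul_nonneg (by nlinarith) (mul_nonneg hy0 (by linarith))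
  nlinarith

/-- A quadratic majorant of `signPoly` on `[0, 0.126]`. -/
noncomputable def signMajorant (y : ℝ) : ℝ := (0.126 - y) * (0.7835 - 2.35 * y)

lemma signPoly_le_signMajorant {y : ℝ} (hy0 : 0 ≤ y) (hy : y ≤ 0.126) :
    signPoly 2.7047 y ≤ signMajorant y := by
  unfold signPoly signMajorant
  nlinarith [mul_nonneg hy0 (sub_nonneg.2 hy), sq_nonneg (y - 0.06),
    mul_nonneg (sq_nonneg (y - 0.06)) (sub_nonneg.2 hy), mul_nonneg (sq_nonneg (y - 0.06)) hy0]

lemma signPoly_neg {y : ℝ} (hy0 : 0.126 ≤ y) (hy : y ≤ 0.4) : signPoly 2.7047 y < 0 := by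
  unfold signPoly
  nlinarith [mul_nonneg (sub_nonneg.2 hy0) (sub_nonneg.2 hy), sq_nonneg (y - 0.25),
    mul_nonneg (mul_nonneg (sub_nonneg.2 hy0) (sub_nonneg.2 hy)) (sub_nonneg.2 hy0),
    mul_nonneg (mul_nonneg (sub_nonneg.2 hy0) (sub_nonneg.2 hy)) (sub_nonneg.2 hy)]

/-- The antiderivative of `0.17 * y * growthPoly y * signMajorant y`. -/
noncomputable def dipPoly (y : ℝ) : ℝ :=
  1678257 / 200000000 * y ^ 2 - 104653921 / 3000000000 * y ^ 3 - 24492699 / 400000000 * y ^ 4 -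
    47889 / 50000000 * y ^ 5 - 15623 / 300000 * y ^ 6 + 2397 / 1400 * y ^ 7

lemma hasDerivAt_dipPoly (y : ℝ) :
    HasDerivAt dipPoly (0.17 * y * growthPoly y * signMajorant y) y := by
  refine ((((((hasDerivAt_pow 2 y).const_mul (1678257 / 200000000)).sub
    ((hasDerivAt_pow 3 y).const_mul (104653921 / 3000000000))).sub
    ((hasDerivAt_pow 4 y).const_mul (24492699 / 400000000))).sub
    ((hasDerivAt_pow 5 y).const_mul (47889 / 50000000))).sub
    ((hasDerivAt_pow 6 y).const_mul (15623 / 300000))).add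
    ((hasDerivAt_pow 7 y).const_mul (2397 / 1400)) |>.congr_deriv ?_
  unfold growthPoly signMajorant
  push_cast
  norm_num
  ring

lemma dipPoly_le {y : ℝ} (hy0 : 0 ≤ y) (hy : y ≤ 0.126) : dipPoly y ≤ 0.00005 := by
  have hmono := monotoneOn_of_deriv_nonneg (convex_Icc (0 : ℝ) 0.126)
    (fun u _ => (hasDerivAt_dipPoly u).continuousAt.continuousWithinAt)
    (fun u _ => (hasDerivAt_dipPoly u).differentiableAt.differentiableWithinAt)
    (fun u hu => by
      obtain ⟨h1, h2⟩ := interior_subset hu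
      rw [(hasDerivAt_dipPoly u).deriv]
      have := growthPoly_pos h1
      have h3 : 0 ≤ signMajorant u := mul_nonneg (by linarith) (by linarith)
      positivity)
  refine (hmono ⟨hy0, hy⟩ (Set.right_mem_Icc.2 (by norm_num)) hy).trans ?_
  norm_num [dipPoly]

lemma boundaryFactor_mul_boundarySign_ge {z β : ℝ} (hz : 1.6446 ≤ z) (hβ : 0 ≤ β)
    (hy : β ^ 2 ≤ 0.126) :
    -(2 * β * (0.17 * β ^ 2 * growthPoly (β ^ 2) * signMajorant (β ^ 2))) ≤
      boundaryFactor z β * boundarySign z β := by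
  have hs : 2.7047 ≤ z ^ 2 := by nlinarith
  have hy0 : 0 ≤ β ^ 2 := sq_nonneg β
  have h1 : 0 < 1 - β ^ 2 := by linarith
  have hF := boundaryFactor_pos z (β := β) (by linarith)
  have hM : 0 ≤ signMajorant (β ^ 2) := mul_nonneg (by linarith) (by linarith)
  have hsign : -(z * β * β ^ 2 / (1 - β ^ 2) ^ 5 * signMajorant (β ^ 2)) ≤ boundarySign z β := by
    refine le_trans (neg_le_neg ?_) (boundarySign_ge (by linarith) hβ (by linarith))
    refine mul_le_mul_of_nonneg_left ((signPoly_le hs hy0 (by linarith)).trans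
      (signPoly_le_signMajorant hy0 hy)) ?_
    have : 0 ≤ z := by linarith
    positivity
  refine le_trans ?_ (mul_le_mul_of_nonneg_left hsign hF.le)
  rw [mul_neg]
  refine neg_le_neg ?_
  have key : boundaryFactor z β * z / (1 - β ^ 2) ^ 5 ≤ 2 * (0.17 * growthPoly (β ^ 2)) := by
    unfold boundaryFactor
    set τ := √(1 - β ^ 2) with hτ_def
    have hτ : 0 < τ := Real.sqrt_pos.2 h1
    have hτ2 : τ ^ 2 = 1 - β ^ 2 := Real.sq_sqrt h1.le
    have e5 : (1 - β ^ 2) ^ 5 = τ ^ 10 := by rw [← hτ2]; ring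
    have eexp : -(z ^ 2 + β ^ 2) / (2 * (1 - β ^ 2)) =
        -(z ^ 2 / 2) + -((z ^ 2 + 1) / 2 * (β ^ 2 / (1 - β ^ 2))) := by
      field_simp; ring
    have hexp : Real.exp (-((z ^ 2 + 1) / 2 * (β ^ 2 / (1 - β ^ 2)))) ≤
        growthPoly (β ^ 2) * τ ^ 13 := by
      refine le_trans (Real.exp_le_exp.2 (neg_le_neg ?_)) (exp_neg_le_growthPoly hy0 hy)
      exact mul_le_mul_of_nonneg_right (by linarith) (by positivity)
    have hA : z * (√(2 * Real.pi))⁻¹ * Real.exp (-(z ^ 2 / 2)) ≤ 0.17 := by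
      rw [Real.exp_neg, ← div_eq_mul_inv, div_le_iff₀ (Real.exp_pos _)]
      exact mul_inv_sqrt_two_pi_le hz
    rw [e5, eexp, Real.exp_add, div_mul_eq_mul_div, div_div, ← pow_add,
      div_le_iff₀ (by positivity)]
    have := mul_le_mul hA hexp (Real.exp_pos _).le (by norm_num)
    norm_num at this ⊢
    linarith
  have hn : 0 ≤ β * β ^ 2 * signMajorant (β ^ 2) := by positivity
  calc boundaryFactor z β * (z * β * β ^ 2 / (1 - β ^ 2) ^ 5 * signMajorant (β ^ 2))
      = boundaryFactor z β * z / (1 - β ^ 2) ^ 5 * (β * β ^ 2 * signMajorant (β ^ 2)) := by ring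
    _ ≤ 2 * (0.17 * growthPoly (β ^ 2)) * (β * β ^ 2 * signMajorant (β ^ 2)) :=
        mul_le_mul_of_nonneg_right key hn
    _ = 2 * β * (0.17 * β ^ 2 * growthPoly (β ^ 2) * signMajorant (β ^ 2)) := by ring

lemma boundaryCoverage_ge_of_sq_le {z β : ℝ} (hz : 1.6446 ≤ z) (hβ : 0 ≤ β)
    (hy : β ^ 2 ≤ 0.126) : 2 * normalMass z - 0.00005 ≤ boundaryCoverage z β := by
  have hsq : ∀ b ∈ Set.Icc 0 β, b ^ 2 ≤ 0.126 := fun b hb => by nlinarith [hb.1, hb.2]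
  have hd : ∀ b ∈ Set.Icc 0 β, HasDerivAt (fun b => boundaryCoverage z b + dipPoly (b ^ 2))
      (boundaryFactor z b * boundarySign z b +
        0.17 * b ^ 2 * growthPoly (b ^ 2) * signMajorant (b ^ 2) * (2 * b)) b := by
    intro b hb
    have h2 := (hasDerivAt_dipPoly (b ^ 2)).comp b (hasDerivAt_pow 2 b)
    refine ((hasDerivAt_boundaryCoverage z (by linarith [hsq b hb])).add h2).congr_deriv ?_
    simp
  have hmono := monotoneOn_of_deriv_nonneg (convex_Icc 0 β)
    (fun b hb => (hd b hb).continuousAt.continuousWithinAt)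
    (fun b hb => (hd b (interior_subset hb)).differentiableAt.differentiableWithinAt)
    (fun b hb => by
      have hb' := interior_subset hb
      rw [(hd b hb').deriv]
      linarith [boundaryFactor_mul_boundarySign_ge hz hb'.1 (hsq b hb')])
  have h := hmono (Set.left_mem_Icc.2 hβ) (Set.right_mem_Icc.2 hβ) hβ
  have h0 : dipPoly (0 ^ 2) = 0 := by simp [dipPoly]
  simp only [boundaryCoverage_zero, h0] at h
  linarith [dipPoly_le (sq_nonneg β) hy]

lemma boundaryCoverage_ge {z β : ℝ} (hz : 1.6446 ≤ z) (hβ : 0 ≤ β) (hβ1 : β < 1) :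
    2 * normalMass z - 0.00005 ≤ boundaryCoverage z β := by
  rcases le_or_gt (β ^ 2) 0.126 with hy | hy
  · exact boundaryCoverage_ge_of_sq_le hz hβ hy
  · have h0 : √0.126 ^ 2 = (0.126 : ℝ) := Real.sq_sqrt (by norm_num)
    refine (boundaryCoverage_ge_of_sq_le hz (Real.sqrt_nonneg 0.126) h0.le).trans ?_
    refine (boundaryCoverage_lt (Real.sqrt_nonneg _) ((Real.sqrt_lt' ?_).2 hy) hβ1 ?_).le
    · exact lt_of_le_of_ne hβ fun h => by rw [← h] at hy; norm_num at hy
    · intro b hb _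
      have hb0 : 0 < b := (Real.sqrt_nonneg _).trans_lt hb
      have hbsq : 0.126 < b ^ 2 := (Real.sqrt_lt' hb0).1 hb
      rcases le_or_gt (b ^ 2) 0.4 with h4 | h4
      · refine lt_of_lt_of_le ?_ (boundarySign_ge (by linarith) hb0.le (by linarith))
        have h1 : 0 < 1 - b ^ 2 := by linarith
        have hneg := (signPoly_le (s := z ^ 2) (by nlinarith) (sq_nonneg b)
          (by linarith)).trans_lt (signPoly_neg hbsq.le h4)
        have hz0 : 0 < z := by linarith
        have : 0 < z * b * b ^ 2 / (1 - b ^ 2) ^ 5 := by positivity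
        nlinarith
      · refine boundarySign_pos_of_one_le ?_
        nlinarith

lemma stdNormalQuantile_spec {α : ℝ} (h0 : 0 < α) (h1 : α < 1) :
    2 * normalMass (stdNormalQuantile (1 - α / 2)) = 1 - α := by
  rw [normalMass_stdNormalQuantile (by linarith) (by linarith)]
  ring

lemma lt_stdNormalQuantile {α x : ℝ} (h0 : 0 < α) (h1 : α < 1) (hx : 2 * normalMass x < 1 - α) :
    x < stdNormalQuantile (1 - α / 2) := by
  rw [← strictMono_normalMass.lt_iff_lt]
  linarith [stdNormalQuantile_spec h0 h1]

lemma lt_stdNormalQuantile_tenth : 1.6446 < stdNormalQuantile (1 - 0.1 / 2) :=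
  lt_stdNormalQuantile (by norm_num) (by norm_num) (by linarith [normalMass_lt_nine_twentieths])

namespace NormalEstimators

variable {Ω : Type*} [MeasurableSpace Ω] {P : Measure Ω}
  {est₁ est₂ : Ω → ℝ} {θ b₂ s₁ s₂ α : ℝ}

lemma MSE_fst [IsProbabilityMeasure P]
    (h : NormalEstimators P est₁ est₂ θ b₂ s₁ s₂) : MSE P est₁ θ = s₁ ^ 2 := by
  rw [MSE_of_hasLaw (b := 0) (s := s₁) (by simpa using h.law₁)]
  ring

lemma MSE_snd [IsProbabilityMeasure P]
    (h : NormalEstimators P est₁ est₂ θ b₂ s₁ s₂) :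
    MSE P est₂ θ = b₂ ^ 2 + s₂ ^ 2 :=
  MSE_of_hasLaw h.law₂

lemma MSE_le_iff [IsProbabilityMeasure P]
    (h : NormalEstimators P est₁ est₂ θ b₂ s₁ s₂) :
    MSE P est₂ θ ≤ MSE P est₁ θ ↔ |b₂| ^ 2 + s₂ ^ 2 ≤ s₁ ^ 2 := by
  rw [h.MSE_fst, h.MSE_snd, sq_abs]

lemma coverageProb_snd (h : NormalEstimators P est₁ est₂ θ b₂ s₁ s₂) (hs : 0 < s₂)
    (hq : 0 ≤ stdNormalQuantile (1 - α / 2)) :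
    coverageProb P (normalCI est₂ s₁ α) θ =
      normalMass ((stdNormalQuantile (1 - α / 2) * s₁ - |b₂|) / s₂) +
        normalMass ((stdNormalQuantile (1 - α / 2) * s₁ + |b₂|) / s₂) := by
  rw [coverageProb_normalCI hs h.s₁_pos hq h.law₂]
  rcases abs_cases b₂ with ⟨e, _⟩ | ⟨e, _⟩ <;> rw [e]
  rw [sub_neg_eq_add, ← sub_eq_add_neg, add_comm]

lemma abs_bias_le [IsProbabilityMeasure P]
    (h : NormalEstimators P est₁ est₂ θ b₂ s₁ s₂)
    (hM : MSE P est₂ θ ≤ MSE P est₁ θ) : |b₂| ≤ s₁ := by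
  rw [h.MSE_le_iff] at hM
  exact abs_le_of_sq_le_sq (by nlinarith [sq_abs b₂]) h.s₁_pos.le

lemma coverageProb_eq_one_of_sd_eq_zero [IsProbabilityMeasure P]
    (h : NormalEstimators P est₁ est₂ θ b₂ s₁ s₂)
    (hM : MSE P est₂ θ ≤ MSE P est₁ θ) (hq : 1 ≤ stdNormalQuantile (1 - α / 2)) (hs : s₂ = 0) :
    coverageProb P (normalCI est₂ s₁ α) θ = 1 := by
  refine coverageProb_normalCI_of_sd_eq_zero (b := b₂) ?_ (hs ▸ h.law₂)
  nlinarith [h.abs_bias_le hM, h.s₁_pos]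

lemma sd_eq_zero [IsProbabilityMeasure P]
    (h : NormalEstimators P est₁ est₂ θ b₂ s₁ s₂)
    (hM : MSE P est₂ θ ≤ MSE P est₁ θ) (hb : |b₂| = s₁) : s₂ = 0 := by
  rw [h.MSE_le_iff, hb] at hM
  exact pow_eq_zero_iff two_ne_zero |>.1 (le_antisymm (by linarith) (sq_nonneg s₂))

/-- At given bias the coverage is smallest when the mean squared errors agree. -/
lemma boundaryCoverage_le [IsProbabilityMeasure P]
    (h : NormalEstimators P est₁ est₂ θ b₂ s₁ s₂)
    (hM : MSE P est₂ θ ≤ MSE P est₁ θ) (hq : 1 ≤ stdNormalQuantile (1 - α / 2))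
    (hb : |b₂| < s₁) : boundaryCoverage (stdNormalQuantile (1 - α / 2)) (|b₂| / s₁) ≤
      coverageProb P (normalCI est₂ s₁ α) θ := by
  have hs₁ := h.s₁_pos
  rcases h.s₂_nonneg.eq_or_lt with hs | hs
  · rw [h.coverageProb_eq_one_of_sd_eq_zero hM hq hs.symm]
    exact (boundaryCoverage_lt_one _ _).le
  · rw [h.coverageProb_snd hs (by linarith), boundaryCoverage]
    rw [h.MSE_le_iff] at hM
    set q := stdNormalQuantile (1 - α / 2)
    have hτ : 0 < √(1 - (|b₂| / s₁) ^ 2) := by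
      refine Real.sqrt_pos.2 ?_
      have := pow_lt_one₀ (by positivity) ((div_lt_one hs₁).2 hb) two_ne_zero
      linarith
    have hle : s₂ / s₁ ≤ √(1 - (|b₂| / s₁) ^ 2) := by
      refine Real.le_sqrt_of_sq_le ?_
      rw [div_pow, div_pow, le_sub_iff_add_le, ← add_div, div_le_one (by positivity)]
      linarith
    have hmono : ∀ c, 0 ≤ c → c / √(1 - (|b₂| / s₁) ^ 2) ≤ c * s₁ / s₂ := by
      intro c hc
      rw [div_le_iff₀ hτ]
      calc c = c * s₁ / s₂ * (s₂ / s₁) := by field_simp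
        _ ≤ _ := mul_le_mul_of_nonneg_left hle (by positivity)
    have hb1 : |b₂| / s₁ < 1 := (div_lt_one hs₁).2 hb
    have hb0 : 0 ≤ |b₂| / s₁ := by positivity
    refine add_le_add (strictMono_normalMass.monotone ((hmono _ (by linarith)).trans_eq ?_))
      (strictMono_normalMass.monotone ((hmono _ (by linarith)).trans_eq ?_))
    · rw [sub_mul, div_mul_cancel₀ _ hs₁.ne']
    · rw [add_mul, div_mul_cancel₀ _ hs₁.ne']

lemma coverageProb_eq_boundaryCoverage [IsProbabilityMeasure P]
    (h : NormalEstimators P est₁ est₂ θ b₂ s₁ s₂)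
    (hM : MSE P est₂ θ = MSE P est₁ θ) (hq : 0 ≤ stdNormalQuantile (1 - α / 2))
    (hb : |b₂| < s₁) : coverageProb P (normalCI est₂ s₁ α) θ =
      boundaryCoverage (stdNormalQuantile (1 - α / 2)) (|b₂| / s₁) := by
  have hs₁ := h.s₁_pos
  rw [h.MSE_fst, h.MSE_snd] at hM
  have hsq : 0 < s₂ ^ 2 := by nlinarith [sq_abs b₂, abs_nonneg b₂]
  have hs : 0 < s₂ := lt_of_le_of_ne h.s₂_nonneg fun e => by simp [← e] at hsq
  have hτ : √(1 - (|b₂| / s₁) ^ 2) = s₂ / s₁ := by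
    rw [Real.sqrt_eq_iff_mul_self_eq_of_pos (by positivity)]
    rw [div_pow, sq_abs]
    field_simp
    linarith
  rw [h.coverageProb_snd hs hq, boundaryCoverage, hτ]
  congr 2 <;> field_simp

lemma coverageProb_fst (h : NormalEstimators P est₁ est₂ θ b₂ s₁ s₂) (h0 : 0 < α) (h1 : α < 1) :
    coverageProb P (normalCI est₁ s₁ α) θ = 1 - α := by
  have hq : 0 < stdNormalQuantile (1 - α / 2) := lt_stdNormalQuantile h0 h1 (by simpa using h1)
  rw [coverageProb_normalCI (b := 0) h.s₁_pos h.s₁_pos hq.le (by simpa using h.law₁), sub_zero,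
    add_zero, mul_div_cancel_right₀ _ h.s₁_pos.ne', ← two_mul, stdNormalQuantile_spec h0 h1]

/-- Chebyshev's inequality bounds the probability of noncoverage by the variance. -/
lemma one_sub_le_coverageProb [IsProbabilityMeasure P]
    (h : NormalEstimators P est₁ est₂ θ b₂ s₁ s₂)
    (hM : MSE P est₂ θ ≤ MSE P est₁ θ) (hq : 3 / 2 < stdNormalQuantile (1 - α / 2)) :
    1 - 4 * (s₂ / s₁) ^ 2 ≤ coverageProb P (normalCI est₂ s₁ α) θ := by
  have hs₁ := h.s₁_pos
  have hb := h.abs_bias_le hM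
  have hm : MemLp est₂ 2 P := by
    have := memLp_id_gaussianReal' (μ := θ + b₂) (v := Real.toNNReal (s₂ ^ 2)) 2 (by simp)
    rw [← h.law₂.map_eq] at this
    exact (memLp_map_measure_iff (by fun_prop) h.law₂.aemeasurable).1 this
  have hc := meas_ge_le_variance_div_sq hm (c := s₁ / 2) (by positivity)
  rw [h.law₂.variance_eq, variance_id_gaussianReal, h.law₂.integral_eq,
    integral_id_gaussianReal, Real.coe_toNNReal _ (sq_nonneg s₂)] at hc
  have hc' := ENNReal.toReal_mono ENNReal.ofReal_ne_top hc
  rw [ENNReal.toReal_ofReal (by positivity), ← measureReal_def] at hc'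
  have hcover : Set.univ ⊆ {ω | θ ∈ normalCI est₂ s₁ α ω} ∪
      {ω | s₁ / 2 ≤ |est₂ ω - (θ + b₂)|} := by
    intro ω _
    rcases le_or_gt (s₁ / 2) |est₂ ω - (θ + b₂)| with hω | hω
    · exact Or.inr hω
    · refine Or.inl ?_
      rw [abs_lt] at hω
      rw [abs_le] at hb
      have : 3 / 2 * s₁ < stdNormalQuantile (1 - α / 2) * s₁ :=
        mul_lt_mul_of_pos_right hq hs₁
      constructor <;> linarith
  have h1 := (measureReal_mono (μ := P) hcover).trans (measureReal_union_le _ _)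
  rw [probReal_univ] at h1
  have e : s₂ ^ 2 / (s₁ / 2) ^ 2 = 4 * (s₂ / s₁) ^ 2 := by field_simp; ring
  rw [e] at hc'
  unfold coverageProb
  linarith

end NormalEstimators

theorem corollary1 :
    -- the benchmark interval centered at `est₁` has exact coverage
    (∀ {Ω : Type*} [MeasurableSpace Ω] (P : Measure Ω) [IsProbabilityMeasure P]
      (est₁ est₂ : Ω → ℝ) (θ b₂ s₁ s₂ α : ℝ),
      NormalEstimators P est₁ est₂ θ b₂ s₁ s₂ → MSE P est₂ θ ≤ MSE P est₁ θ →
      0 < α → α < 1 →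
      coverageProb P (normalCI est₁ s₁ α) θ = 1 - α) ∧
    -- confidence levels of at least 91.7%
    (∀ {Ω : Type*} [MeasurableSpace Ω] (P : Measure Ω) [IsProbabilityMeasure P]
      (est₁ est₂ : Ω → ℝ) (θ b₂ s₁ s₂ α : ℝ),
      NormalEstimators P est₁ est₂ θ b₂ s₁ s₂ → MSE P est₂ θ ≤ MSE P est₁ θ →
      0 < α → 0.917 ≤ 1 - α → b₂ ≠ 0 →
      1 - α < coverageProb P (normalCI est₂ s₁ α) θ) ∧
    -- confidence level 90%: coverage of at least 90.00% after rounding to two decimals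
    (∀ {Ω : Type*} [MeasurableSpace Ω] (P : Measure Ω) [IsProbabilityMeasure P]
      (est₁ est₂ : Ω → ℝ) (θ b₂ s₁ s₂ : ℝ),
      NormalEstimators P est₁ est₂ θ b₂ s₁ s₂ → MSE P est₂ θ ≤ MSE P est₁ θ →
      0.89995 ≤ coverageProb P (normalCI est₂ s₁ 0.1) θ) ∧
    -- confidence level 90%: coverage tends to 100% as `|b₂| → s₁`, uniformly in everything else
    (∀ s₁ : ℝ, 0 < s₁ → ∀ ε : ℝ, 0 < ε → ∃ δ : ℝ, 0 < δ ∧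
      ∀ {Ω : Type*} [MeasurableSpace Ω] (P : Measure Ω) [IsProbabilityMeasure P]
        (est₁ est₂ : Ω → ℝ) (θ b₂ s₂ : ℝ),
        NormalEstimators P est₁ est₂ θ b₂ s₁ s₂ → MSE P est₂ θ ≤ MSE P est₁ θ →
        s₁ - δ < |b₂| →
        1 - ε < coverageProb P (normalCI est₂ s₁ 0.1) θ) ∧
    -- confidence level 90%: once `|b₂|` is close to `s₁`, the coverage increases along the equal-MSE
    -- boundary, and the boundary value is exceeded by every admissible one of larger bias
    (∀ s₁ : ℝ, 0 < s₁ → ∃ b₀ : ℝ, b₀ < s₁ ∧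
      ∀ {Ω Ω' : Type*} [MeasurableSpace Ω] [MeasurableSpace Ω']
        (P : Measure Ω) [IsProbabilityMeasure P] (P' : Measure Ω') [IsProbabilityMeasure P']
        (est₁ est₂ : Ω → ℝ) (est₁' est₂' : Ω' → ℝ) (θ θ' b₂ b₂' s₂ s₂' : ℝ),
        NormalEstimators P est₁ est₂ θ b₂ s₁ s₂ → MSE P est₂ θ = MSE P est₁ θ →
        NormalEstimators P' est₁' est₂' θ' b₂' s₁ s₂' → MSE P' est₂' θ' ≤ MSE P' est₁' θ' →
        b₀ ≤ |b₂| → |b₂| < |b₂'| →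
        coverageProb P (normalCI est₂ s₁ 0.1) θ < coverageProb P' (normalCI est₂' s₁ 0.1) θ') := by
  refine ⟨?_, ?_, ?_, ?_, ?_⟩
  · intro Ω _ P _ est₁ est₂ θ b₂ s₁ s₂ α h _ h0 h1
    exact h.coverageProb_fst h0 h1
  · intro Ω _ P _ est₁ est₂ θ b₂ s₁ s₂ α h hM h0 hα hb
    have h1 : α < 1 := by linarith
    have hq : 1.7325 < stdNormalQuantile (1 - α / 2) :=
      lt_stdNormalQuantile h0 h1 (by linarith [normalMass_lt_of_sqrt_three])
    rcases (h.abs_bias_le hM).eq_or_lt with he | hlt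
    · rw [h.coverageProb_eq_one_of_sd_eq_zero hM (by linarith) (h.sd_eq_zero hM he)]
      linarith
    · refine lt_of_lt_of_le ?_ (h.boundaryCoverage_le hM (by linarith) hlt)
      rw [← stdNormalQuantile_spec h0 h1]
      exact boundaryCoverage_zero_lt (by linarith) (by nlinarith)
        (div_pos (abs_pos.2 hb) h.s₁_pos) ((div_lt_one h.s₁_pos).2 hlt)
  · intro Ω _ P _ est₁ est₂ θ b₂ s₁ s₂ h hM
    have hq := lt_stdNormalQuantile_tenth
    rcases (h.abs_bias_le hM).eq_or_lt with he | hlt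
    · rw [h.coverageProb_eq_one_of_sd_eq_zero hM (by linarith) (h.sd_eq_zero hM he)]
      norm_num
    · refine le_trans ?_ (h.boundaryCoverage_le hM (by linarith) hlt)
      refine le_trans ?_ (boundaryCoverage_ge hq.le
        (div_nonneg (abs_nonneg _) h.s₁_pos.le) ((div_lt_one h.s₁_pos).2 hlt))
      rw [stdNormalQuantile_spec (by norm_num) (by norm_num)]
      norm_num
  · intro s₁ hs₁ ε hε
    refine ⟨ε * s₁ / 8, by positivity, ?_⟩
    intro Ω _ P _ est₁ est₂ θ b₂ s₂ h hM hb
    refine lt_of_lt_of_le ?_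
      (h.one_sub_le_coverageProb hM (by linarith [lt_stdNormalQuantile_tenth]))
    have hle := h.abs_bias_le hM
    rw [h.MSE_le_iff] at hM
    have : 4 * (s₂ / s₁) ^ 2 < ε := by
      rw [div_pow, ← mul_div_assoc, div_lt_iff₀ (by positivity)]
      nlinarith [abs_nonneg b₂]
    linarith
  · intro s₁ hs₁
    have hq := lt_stdNormalQuantile_tenth
    set q := stdNormalQuantile (1 - 0.1 / 2) with hq_def
    refine ⟨s₁ / q, div_lt_self hs₁ (by linarith), ?_⟩
    intro Ω Ω' _ _ P _ P' _ est₁ est₂ est₁' est₂' θ θ' b₂ b₂' s₂ s₂' h hM h' hM' hb hlt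
    have hle' := h'.abs_bias_le hM'
    rw [h.coverageProb_eq_boundaryCoverage hM (by linarith) (hlt.trans_le hle')]
    rcases hle'.eq_or_lt with he | hlt'
    · rw [h'.coverageProb_eq_one_of_sd_eq_zero hM' (by linarith) (h'.sd_eq_zero hM' he)]
      exact boundaryCoverage_lt_one _ _
    · refine lt_of_lt_of_le ?_ (h'.boundaryCoverage_le hM' (by linarith) hlt')
      refine boundaryCoverage_lt (by positivity) (div_lt_div_of_pos_right hlt hs₁)
        ((div_lt_one hs₁).2 hlt') fun β hβ _ => boundarySign_pos_of_one_le ?_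
      have h1 : 1 / q ≤ |b₂| / s₁ := by
        rw [le_div_iff₀ hs₁]
        exact le_trans (le_of_eq (by ring)) hb
      have h2 : 1 / q < β := h1.trans_lt hβ
      rw [div_lt_iff₀ (by linarith)] at h2
      rw [← hq_def]
      linarith
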